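/- Let $\|\cdot\|$ be any norm on $\mathbb{R}^d$ and let $f\colon\mathbb{R}^d\to\mathbb{R}$ be piecewise affine, i.e. there are finitely many polyhedral sets (intersections of finitely many closed half-spaces) $Q_1,\dots,Q_s$ covering $\mathbb{R}^d$, with nonempty and pairwise disjoint interiors, such that $f$ coincides with an affine function on each $Q_i$. Let $S(f)=\{x\in\mathbb{R}^d : f(x)\le 0\}$ be nonempty, and let $V\subseteq\mathbb{R}^d$ be any set. We say that $f$ has an error bound on $V$ if there exists $\tau>0$ such that $\tau\,\operatorname{dist}(x,S(f))\le\max\{f(x),0\}$ for all $x\in V$, where $\operatorname{dist}(x,Q)=\inf_{y\in Q}\|x-y\|$. Then: 1. If $$\liminf_{\|x\|\to+\infty,\ x\in V}\frac{f(x)}{\|x\|}>0 \qquad (\ast)$$ (the lower limit being $+\infty$ if $V$ is bounded), then $f$ has an error bound on $V$. 2. If $0^+S(f)\cap\operatorname{cl}\operatorname{cone}V=\{0\}$ and $f$ has an error bound on $V$, then $(\ast)$ holds. Here $0^+Q$ is the set of all $z\in\mathbb{R}^d$ for which there is $x\in Q$ with $x+\lambda z\in Q$ for all $\lambda\ge0$;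 $\operatorname{cone}V$ is the smallest (not necessarily convex) cone containing $V$, a cone being a set closed under multiplication by nonnegative scalars; and $\operatorname{cl}$ denotes the closure. -/

import Mathlib

namespace NonlocalErrorBound

section Definitions

variable {E : Type*} [NormedAddCommGroup E] [NormedSpace ℝ E]

/-- A closed half-space `{x | ℓ x ≤ b}` with `ℓ` a nonzero linear functional. -/
def IsClosedHalfSpace (H : Set E) : Prop :=
  ∃ (l : E →ₗ[ℝ] ℝ) (b : ℝ), l ≠ 0 ∧ H = {x | l x ≤ b}

/-- A polyhedral set: the intersection of finitely many closed half-spaces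
(the empty intersection being the whole space). -/
def IsPolyhedral (Q : Set E) : Prop :=
  ∃ (n : ℕ) (H : Fin n → Set E), (∀ k, IsClosedHalfSpace (H k)) ∧ Q = ⋂ k, H k

/-- A polyhedral partition of the space: finitely many polyhedral sets covering the space, with
nonempty and pairwise disjoint interiors. -/
structure IsPolyhedralPartition {s : ℕ} (Q : Fin s → Set E) : Prop where
  polyhedral : ∀ i, IsPolyhedral (Q i)
  iUnion_eq : ⋃ i, Q i = Set.univ
  interior_nonempty : ∀ i, (interior (Q i)).Nonempty
  interior_disjoint : ∀ i j, i ≠ j → interior (Q i) ∩ interior (Q j) = ∅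

/-- A real-valued piecewise affine function: on each cell of some polyhedral partition it
coincides with an affine function. -/
def IsPiecewiseAffine (f : E → ℝ) : Prop :=
  ∃ (s : ℕ) (Q : Fin s → Set E), IsPolyhedralPartition Q ∧
    ∃ F : Fin s → (E →ᵃ[ℝ] ℝ), ∀ i, ∀ x ∈ Q i, f x = F i x

/-- The lower `0`-level set `S(f)`. -/
def lowerLevelSet (f : E → ℝ) : Set E := {x | f x ≤ 0}

/-- `f` has an error bound on `V`: `τ dist(x, S(f)) ≤ max {f(x), 0}` on `V` for some `τ > 0`. -/
def HasErrorBoundOn (f : E → ℝ) (V : Set E) : Prop :=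
  ∃ τ : ℝ, 0 < τ ∧ ∀ x ∈ V, τ * Metric.infDist x (lowerLevelSet f) ≤ max (f x) 0

/-- The recession cone `0⁺Q`: directions of the rays contained in `Q`. -/
def recessionCone (Q : Set E) : Set E :=
  {z | ∃ x ∈ Q, ∀ t : ℝ, 0 ≤ t → x + t • z ∈ Q}

/-- A cone, not necessarily convex: a set closed under multiplication by nonnegative reals. -/
def IsCone (K : Set E) : Prop := ∀ x ∈ K, ∀ t : ℝ, 0 ≤ t → t • x ∈ K

/-- The conic hull of `V`: the smallest (not necessarily convex) cone containing `V`. -/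
def conicHull (V : Set E) : Set E := ⋂₀ {K | IsCone K ∧ V ⊆ K}

theorem mem_conicHull {V : Set E} {x : E} :
    x ∈ conicHull V ↔ ∃ t : ℝ, 0 ≤ t ∧ ∃ v ∈ V, x = t • v := by
  constructor
  · intro h
    refine h {y | ∃ t : ℝ, 0 ≤ t ∧ ∃ v ∈ V, y = t • v} ⟨?_, ?_⟩
    · rintro _ ⟨t, ht, v, hv, rfl⟩ r hr
      exact ⟨r * t, mul_nonneg hr ht, v, hv, by rw [mul_smul]⟩
    · intro v hv
      exact ⟨1, zero_le_one, v, hv, by rw [one_smul]⟩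
  · rintro ⟨t, ht, v, hv, rfl⟩ K ⟨hK, hVK⟩
    exact hK v (hVK hv) t ht

/-- The condition `liminf_{‖x‖ → ∞, x ∈ V} f(x)/‖x‖ > 0`. The lower limit is taken in the extended
reals, so it equals `+∞` when `V` is bounded. -/
def HasPositiveGrowthOn (f : E → ℝ) (V : Set E) : Prop :=
  (0 : EReal) < Filter.liminf (fun x : E => ((f x / ‖x‖ : ℝ) : EReal))
    (Filter.comap (fun x : E => ‖x‖) Filter.atTop ⊓ Filter.principal V)

end Definitions

end NonlocalErrorBound

/-! On a polytope where an affine `F` is nonnegative, distance to a convex set is convex while `C *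
F` is affine, so distance `≤ C * F` need only be checked at the finitely many vertices
(`exists_infDist_le_affine`). Applied cell by cell, this gives an error bound on every bounded set.
Under the growth condition, far points of `V` have distance to S(f) of order at most ‖x‖, which `f`
dominates; this is part 1.

For part 2, failure of growth gives points of `V` going to infinity with f(x) < ε‖x‖, ε → 0. The
error bound puts points of S(f) within o(‖x‖) of them, so both normalised sequences share a unit
limit `z` in cl cone V. By `IsPiecewiseAffine.mem_recessionCone_of_tendsto`, `z` is also a recession
direction, a contradiction. -/

namespace NonlocalErrorBound

open Filter Topology Set

section HalfSpaceIntersections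

variable {E : Type*} [NormedAddCommGroup E] [NormedSpace ℝ E]

/-- A finite intersection of sets `{x | l x ≤ b}`, where `l` may vanish. -/
def IsFiniteHalfSpaceInter (Q : Set E) : Prop :=
  ∃ A : Set ((E →ₗ[ℝ] ℝ) × ℝ), A.Finite ∧ Q = {x | ∀ p ∈ A, p.1 x ≤ p.2}

theorem IsPolyhedral.isFiniteHalfSpaceInter {Q : Set E} (hQ : IsPolyhedral Q) :
    IsFiniteHalfSpaceInter Q := by
  obtain ⟨n, H, hH, rfl⟩ := hQ
  choose l b _ hlb using hH
  refine ⟨range fun k => (l k, b k), finite_range _, ?_⟩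
  ext x
  simp [hlb]

theorem IsFiniteHalfSpaceInter.inter {P Q : Set E} (hP : IsFiniteHalfSpaceInter P)
    (hQ : IsFiniteHalfSpaceInter Q) : IsFiniteHalfSpaceInter (P ∩ Q) := by
  obtain ⟨A, hA, rfl⟩ := hP
  obtain ⟨B, hB, rfl⟩ := hQ
  refine ⟨A ∪ B, hA.union hB, ?_⟩
  ext x
  simp only [mem_inter_iff, mem_ofPred_eq, mem_union, or_imp, forall_and]

theorem isFiniteHalfSpaceInter_affine_le (F : E →ᵃ[ℝ] ℝ) :
    IsFiniteHalfSpaceInter {x | F x ≤ 0} := by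
  refine ⟨{(F.linear, -F 0)}, finite_singleton _, ?_⟩
  ext x
  have h : F x = F.linear x + F 0 := congrFun F.decomp x
  simp only [mem_ofPred_eq, mem_singleton_iff, forall_eq, h]
  constructor <;> intro <;> linarith

theorem IsFiniteHalfSpaceInter.convex {Q : Set E} (hQ : IsFiniteHalfSpaceInter Q) :
    Convex ℝ Q := by
  obtain ⟨A, -, rfl⟩ := hQ
  intro x hx y hy a b ha hb hab p hp
  rw [map_add, map_smul, map_smul, smul_eq_mul, smul_eq_mul]
  calc a * p.1 x + b * p.1 y ≤ a * p.2 + b * p.2 := by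
        gcongr
        · exact hx p hp
        · exact hy p hp
    _ = p.2 := by rw [← add_mul, hab, one_mul]

/-- An extreme point is determined by the constraints active at it. -/
theorem IsFiniteHalfSpaceInter.finite_extremePoints {Q : Set E}
    (hQ : IsFiniteHalfSpaceInter Q) : (Q.extremePoints ℝ).Finite := by
  obtain ⟨A, hA, rfl⟩ := hQ
  refine Set.Finite.of_injOn (f := fun x => {p ∈ A | p.1 x = p.2}) (t := 𝒫 A)
    (fun x _ => sep_subset _ _) ?_ hA.finite_subsets
  intro x hx y hy hxy
  have hact : ∀ p ∈ A, p.1 x = p.2 → p.1 y = p.2 := fun p hp h =>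
    ((Set.ext_iff.1 hxy p).1 ⟨hp, h⟩).2
  -- The segment from `y` to `x` extends slightly beyond `x` inside the set: active constraints stay
  -- equalities, slack ones stay slack.
  have hev : ∀ᶠ t : ℝ in 𝓝[>] 0, ∀ p ∈ A, p.1 (x + t • (x - y)) ≤ p.2 := by
    refine (eventually_all_finite hA).2 fun p hp => ?_
    simp only [map_add, map_smul, map_sub, smul_eq_mul]
    rcases (hx.1 p hp).eq_or_lt with h | h
    · refine Eventually.of_forall fun t => ?_
      rw [h, hact p hp h]
      simp
    · have hc : Tendsto (fun t : ℝ => p.1 x + t * (p.1 x - p.1 y)) (𝓝[>] 0) (𝓝 (p.1 x)) := by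
        have : Continuous fun t : ℝ => p.1 x + t * (p.1 x - p.1 y) := by fun_prop
        simpa using (this.tendsto 0).mono_left nhdsWithin_le_nhds
      exact (hc.eventually (gt_mem_nhds h)).mono fun t ht => le_of_lt ht
  obtain ⟨t, ht, ht0⟩ := (hev.and self_mem_nhdsWithin).exists
  have ht0 : 0 < t := ht0
  refine ((mem_extremePoints.1 hx).2 _ ht y hy.1 ?_).2.symm
  refine ⟨1 / (1 + t), t / (1 + t), by positivity, by positivity, by field_simp, ?_⟩
  match_scalars <;> field_simp
  ring

/-- Krein–Milman, where the closure is superfluous because the hull of finitely many points is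
closed. -/
theorem IsFiniteHalfSpaceInter.convexHull_extremePoints {K : Set E}
    (hK : IsFiniteHalfSpaceInter K) (hc : IsCompact K) :
    convexHull ℝ (K.extremePoints ℝ) = K := by
  rw [← (hK.finite_extremePoints.isClosed_convexHull ℝ).closure_eq]
  exact closure_convexHull_extremePoints hc hK.convex

variable [FiniteDimensional ℝ E]

theorem IsFiniteHalfSpaceInter.isClosed {Q : Set E} (hQ : IsFiniteHalfSpaceInter Q) :
    IsClosed Q := by
  obtain ⟨A, -, rfl⟩ := hQ
  simp only [ofPred_forall]
  exact isClosed_biInter fun p _ =>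
    isClosed_le p.1.continuous_of_finiteDimensional continuous_const

/-- Balls of the given norm need not be polyhedral; a cube in coordinates is. -/
theorem exists_isFiniteHalfSpaceInter_compact_superset {s : Set E} (hs : Bornology.IsBounded s) :
    ∃ B : Set E, IsFiniteHalfSpaceInter B ∧ IsCompact B ∧ s ⊆ B := by
  let b := Module.finBasis ℝ E
  let e := b.equivFunL
  obtain ⟨M, hM0, hM⟩ := (e.lipschitz.isBounded_image hs).subset_closedBall_lt 0 0
  refine ⟨e ⁻¹' Metric.closedBall 0 M, ?_, ?_, image_subset_iff.1 hM⟩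
  · refine ⟨(range fun i => (b.coord i, M)) ∪ range fun i => (-b.coord i, M),
      (finite_range _).union (finite_range _), ?_⟩
    ext x
    simp only [mem_preimage, mem_closedBall_zero_iff, pi_norm_le_iff_of_nonneg hM0.le,
      Real.norm_eq_abs, abs_le, mem_ofPred_eq, mem_union, or_imp, forall_and, forall_mem_range,
      LinearMap.neg_apply, neg_le, Module.Basis.coord_apply]
    exact and_comm
  · rw [← e.image_symm_eq_preimage]
    exact (isCompact_closedBall _ _).image e.symm.continuous

end HalfSpaceIntersections

section ErrorBounds

variable {E : Type*} [NormedAddCommGroup E] [NormedSpace ℝ E]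

theorem infDist_combo_le {P : Set E} (hP : Convex ℝ P) (x y : E) {a b : ℝ} (ha : 0 ≤ a)
    (hb : 0 ≤ b) (hab : a + b = 1) :
    Metric.infDist (a • x + b • y) P ≤ a * Metric.infDist x P + b * Metric.infDist y P := by
  rcases P.eq_empty_or_nonempty with rfl | hne
  · simp
  refine le_of_forall_pos_le_add fun ε hε => ?_
  obtain ⟨u, hu, hxu⟩ := (Metric.infDist_lt_iff hne).1
    (lt_add_of_pos_right (Metric.infDist x P) hε)
  obtain ⟨v, hv, hyv⟩ := (Metric.infDist_lt_iff hne).1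
    (lt_add_of_pos_right (Metric.infDist y P) hε)
  calc Metric.infDist (a • x + b • y) P ≤ dist (a • x + b • y) (a • u + b • v) :=
        Metric.infDist_le_dist_of_mem (hP hu hv ha hb hab)
    _ ≤ dist (a • x) (a • u) + dist (b • y) (b • v) := dist_add_add_le _ _ _ _
    _ = a * dist x u + b * dist y v := by
        rw [dist_smul₀, dist_smul₀, Real.norm_of_nonneg ha, Real.norm_of_nonneg hb]
    _ ≤ a * (Metric.infDist x P + ε) + b * (Metric.infDist y P + ε) := by gcongr
    _ = a * Metric.infDist x P + b * Metric.infDist y P + (a + b) * ε := by ring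
    _ = _ := by rw [hab, one_mul]

/-- On a polytope where the affine function `F` is nonnegative, the distance to a convex set
containing the zeros of `F` is controlled by `F`. -/
theorem exists_infDist_le_affine {K P : Set E} (hK : IsFiniteHalfSpaceInter K)
    (hc : IsCompact K) (hP : Convex ℝ P) (F : E →ᵃ[ℝ] ℝ) (hF : ∀ x ∈ K, 0 ≤ F x)
    (hKP : ∀ x ∈ K, F x = 0 → x ∈ P) :
    ∃ C : ℝ, ∀ x ∈ K, Metric.infDist x P ≤ C * F x := by
  obtain ⟨C, hC⟩ := (hK.finite_extremePoints.image fun v => Metric.infDist v P / F v).bddAbove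
  refine ⟨C, ?_⟩
  -- Convexity reduces the bound on `K` to its extreme points.
  have hconv : Convex ℝ {x | Metric.infDist x P ≤ C * F x} := by
    intro x hx y hy a b ha hb hab
    have hx : Metric.infDist x P ≤ C * F x := hx
    have hy : Metric.infDist y P ≤ C * F y := hy
    calc Metric.infDist (a • x + b • y) P
        ≤ a * Metric.infDist x P + b * Metric.infDist y P := infDist_combo_le hP x y ha hb hab
      _ ≤ a * (C * F x) + b * (C * F y) := by gcongr
      _ = C * F (a • x + b • y) := by
        rw [Convex.combo_affine_apply hab, smul_eq_mul, smul_eq_mul]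
        ring
  intro x hx
  rw [← hK.convexHull_extremePoints hc] at hx
  refine convexHull_min (fun v hv => ?_) hconv hx
  rcases (hF v hv.1).eq_or_lt with h | h
  -- Where `F v = 0` the quotient defining `C` says nothing, but then `v` lies in `P`.
  · simp [← h, Metric.infDist_zero_of_mem (hKP v hv.1 h.symm)]
  · exact (div_le_iff₀ h).1 (hC (mem_image_of_mem _ hv))

variable [FiniteDimensional ℝ E]

theorem exists_infDist_lowerLevelSet_le_of_cell {f : E → ℝ} {Q s : Set E}
    (hQ : IsFiniteHalfSpaceInter Q) (F : E →ᵃ[ℝ] ℝ) (hF : ∀ x ∈ Q, f x = F x)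
    (hS : (lowerLevelSet f).Nonempty) (hs : Bornology.IsBounded s) :
    ∃ C : ℝ, ∀ x ∈ Q ∩ s, Metric.infDist x (lowerLevelSet f) ≤ C * max (f x) 0 := by
  obtain ⟨B, hB, hBc, hsB⟩ := exists_isFiniteHalfSpaceInter_compact_superset hs
  -- If the cell misses S(f), `F` has no zero on it and any point of S(f) serves as `P`.
  -- Nonemptiness is essential because `infDist` to the empty set is 0.
  obtain ⟨P, hPconv, hPne, hPS, hQP⟩ : ∃ P : Set E, Convex ℝ P ∧ P.Nonempty ∧
      P ⊆ lowerLevelSet f ∧ ∀ x ∈ Q, F x = 0 → x ∈ P := by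
    have hPS : Q ∩ {x | F x ≤ 0} ⊆ lowerLevelSet f := fun x hx => (hF x hx.1).trans_le hx.2
    rcases (Q ∩ {x | F x ≤ 0}).eq_empty_or_nonempty with h | h
    · obtain ⟨y, hy⟩ := hS
      refine ⟨{y}, convex_singleton y, singleton_nonempty y, singleton_subset_iff.2 hy, ?_⟩
      intro x hx hx0
      exact (eq_empty_iff_forall_notMem.1 h x ⟨hx, hx0.le⟩).elim
    · exact ⟨_, (hQ.inter (isFiniteHalfSpaceInter_affine_le F)).convex, h, hPS,
        fun x hx hx0 => ⟨hx, hx0.le⟩⟩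
  have hneg : ∀ x, x ∈ {x | (-F) x ≤ 0} ↔ 0 ≤ F x := fun x => by simp
  have hK := (hQ.inter hB).inter (isFiniteHalfSpaceInter_affine_le (-F))
  have hKc : IsCompact (Q ∩ B ∩ {x | (-F) x ≤ 0}) :=
    hBc.of_isClosed_subset hK.isClosed fun x hx => hx.1.2
  obtain ⟨C, hC⟩ := exists_infDist_le_affine hK hKc hPconv F (fun x hx => (hneg x).1 hx.2)
    fun x hx => hQP x hx.1.1
  refine ⟨C, fun x hx => ?_⟩
  rcases le_total (f x) 0 with h | h
  · rw [Metric.infDist_zero_of_mem (show x ∈ lowerLevelSet f from h), max_eq_right h, mul_zero]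
  · rw [max_eq_left h, hF x hx.1]
    exact (Metric.infDist_le_infDist_of_subset hPS hPne).trans
      (hC x ⟨⟨hx.1, hsB hx.2⟩, (hneg x).2 (h.trans_eq (hF x hx.1))⟩)

/-- A piecewise affine function has an error bound on every bounded set. -/
theorem IsPiecewiseAffine.exists_infDist_le_of_isBounded {f : E → ℝ} (hf : IsPiecewiseAffine f)
    (hS : (lowerLevelSet f).Nonempty) {s : Set E} (hs : Bornology.IsBounded s) :
    ∃ C : ℝ, ∀ x ∈ s, Metric.infDist x (lowerLevelSet f) ≤ C * max (f x) 0 := by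
  obtain ⟨n, Q, hQ, F, hF⟩ := hf
  choose C hC using fun i => exists_infDist_lowerLevelSet_le_of_cell
    (hQ.polyhedral i).isFiniteHalfSpaceInter (F i) (hF i) hS hs
  obtain ⟨M, hM⟩ := (finite_range C).bddAbove
  refine ⟨M, fun x hx => ?_⟩
  obtain ⟨i, hi⟩ := mem_iUnion.1 (hQ.iUnion_eq ▸ mem_univ x)
  refine (hC i x ⟨hi, hx⟩).trans ?_
  gcongr
  exact hM (mem_range_self i)

theorem hasPositiveGrowthOn_iff {E : Type*} [NormedAddCommGroup E] {f : E → ℝ} {V : Set E} :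
    HasPositiveGrowthOn f V ↔ ∃ c > 0, ∃ R : ℝ, ∀ x ∈ V, R ≤ ‖x‖ → c * ‖x‖ ≤ f x := by
  have hev : ∀ p : E → Prop,
      (∀ᶠ x in comap (fun x : E => ‖x‖) atTop ⊓ 𝓟 V, p x) ↔ ∃ R : ℝ, ∀ x ∈ V, R ≤ ‖x‖ → p x := by
    intro p
    rw [eventually_inf_principal, (atTop_basis.comap _).eventually_iff]
    simp only [true_and, mem_preimage, mem_Ici]
    exact exists_congr fun R => forall_congr' fun x =>
      ⟨fun h hx hR => h hR hx, fun h hR hx => h hx hR⟩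
  constructor
  · intro h
    obtain ⟨c, hc, hcl⟩ := EReal.lt_iff_exists_real_btwn.1 h
    obtain ⟨R, hR⟩ := (hev _).1 (eventually_lt_of_lt_liminf hcl)
    refine ⟨c, EReal.coe_pos.1 hc, max R 1, fun x hx hxR => ?_⟩
    have hpos : 0 < ‖x‖ := zero_lt_one.trans_le ((le_max_right _ _).trans hxR)
    exact ((lt_div_iff₀ hpos).1 (EReal.coe_lt_coe_iff.1
      (hR x hx ((le_max_left _ _).trans hxR)))).le
  · rintro ⟨c, hc, R, hR⟩
    refine (EReal.coe_pos.2 hc).trans_le (le_liminf_of_le (by isBoundedDefault)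
      ((hev _).2 ⟨max R 1, fun x hx hxR => ?_⟩))
    have hpos : 0 < ‖x‖ := zero_lt_one.trans_le ((le_max_right _ _).trans hxR)
    exact EReal.coe_le_coe_iff.2 ((le_div_iff₀ hpos).2 (hR x hx ((le_max_left _ _).trans hxR)))

theorem IsPiecewiseAffine.hasErrorBoundOn {f : E → ℝ} (hf : IsPiecewiseAffine f)
    (hS : (lowerLevelSet f).Nonempty) {V : Set E} (hV : HasPositiveGrowthOn f V) :
    HasErrorBoundOn f V := by
  obtain ⟨c, hc, R, hR⟩ := hasPositiveGrowthOn_iff.1 hV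
  obtain ⟨C, hC⟩ := hf.exists_infDist_le_of_isBounded hS
    (Metric.isBounded_closedBall (x := (0 : E)) (r := max R 1))
  obtain ⟨y, hy⟩ := hS
  have key : ∀ x ∈ V, Metric.infDist x (lowerLevelSet f) ≤
      -- The outer 1 keeps the constant positive, so that its inverse can serve as τ.
      max (max C ((1 + ‖y‖) / c)) 1 * max (f x) 0 := by
    intro x hx
    rcases le_total ‖x‖ (max R 1) with h | h
    · refine (hC x (mem_closedBall_zero_iff.2 h)).trans ?_
      gcongr
      exact (le_max_left _ _).trans (le_max_left _ _)
    · have h1 : 1 ≤ ‖x‖ := (le_max_right _ _).trans h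
      calc Metric.infDist x (lowerLevelSet f) ≤ dist x y := Metric.infDist_le_dist_of_mem hy
        _ ≤ ‖x‖ + ‖y‖ := dist_le_norm_add_norm x y
        _ ≤ (1 + ‖y‖) * ‖x‖ := by nlinarith [norm_nonneg y]
        _ = (1 + ‖y‖) / c * (c * ‖x‖) := by field_simp
        _ ≤ (1 + ‖y‖) / c * max (f x) 0 := by
          gcongr
          exact (hR x hx ((le_max_left _ _).trans h)).trans (le_max_left _ _)
        _ ≤ _ := by
          gcongr
          exact (le_max_right _ _).trans (le_max_left _ _)
  have hpos : 0 < max (max C ((1 + ‖y‖) / c)) 1 := zero_lt_one.trans_le (le_max_right _ _)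
  exact ⟨_, inv_pos.2 hpos, fun x hx => (inv_mul_le_iff₀ hpos).2 (key x hx)⟩

end ErrorBounds

section Recession

variable {E : Type*} [NormedAddCommGroup E] [NormedSpace ℝ E] [FiniteDimensional ℝ E]

/-- Asymptotic directions of the level set of a piecewise affine function are recession
directions. -/
theorem IsPiecewiseAffine.mem_recessionCone_of_tendsto {f : E → ℝ} (hf : IsPiecewiseAffine f)
    {ι : Type*} {L : Filter ι} [L.NeBot] {t : ι → ℝ} {y : ι → E} {z : E}
    (ht0 : ∀ i, 0 ≤ t i) (ht : Tendsto t L (𝓝 0)) (hy : ∀ i, y i ∈ lowerLevelSet f)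
    (hz : Tendsto (fun i => t i • y i) L (𝓝 z)) : z ∈ recessionCone (lowerLevelSet f) := by
  obtain ⟨n, Q, hQ, F, hF⟩ := hf
  have hcover : ∀ i, ∃ j, y i ∈ Q j ∩ {x | F j x ≤ 0} := by
    intro i
    obtain ⟨j, hj⟩ := mem_iUnion.1 (hQ.iUnion_eq ▸ mem_univ (y i))
    exact ⟨j, hj, (hF j _ hj).symm.trans_le (hy i)⟩
  -- Pigeonhole: one of the finitely many cells contains `y i` frequently, which suffices to pass
  -- its inequalities to the limit.
  obtain ⟨j, hj⟩ := frequently_exists.1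
    (Eventually.frequently (Eventually.of_forall hcover : ∀ᶠ i in L, _))
  have hPS : Q j ∩ {x | F j x ≤ 0} ⊆ lowerLevelSet f := fun x hx => (hF j x hx.1).trans_le hx.2
  obtain ⟨A, -, hA⟩ := (hQ.polyhedral j).isFiniteHalfSpaceInter.inter
    (isFiniteHalfSpaceInter_affine_le (F j))
  rw [hA] at hPS hj
  have hlz : ∀ p ∈ A, p.1 z ≤ 0 := by
    intro p hp
    have hlim : Tendsto (fun i => p.1 (t i • y i) - t i * p.2) L (𝓝 (p.1 z)) := by
      simpa using ((p.1.continuous_of_finiteDimensional.tendsto z).comp hz).sub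
        (ht.mul_const p.2)
    refine le_of_tendsto_of_frequently hlim (hj.mono fun i hi => ?_)
    rw [map_smul, smul_eq_mul, ← mul_sub]
    exact mul_nonpos_of_nonneg_of_nonpos (ht0 i) (sub_nonpos.2 (hi p hp))
  obtain ⟨i, hi⟩ := hj.exists
  refine ⟨y i, hy i, fun r hr => hPS fun p hp => ?_⟩
  rw [map_add, map_smul, smul_eq_mul]
  exact (add_le_of_nonpos_right (mul_nonpos_of_nonneg_of_nonpos hr (hlz p hp))).trans (hi p hp)

theorem IsPiecewiseAffine.hasPositiveGrowthOn {f : E → ℝ} (hf : IsPiecewiseAffine f)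
    (hS : (lowerLevelSet f).Nonempty) {V : Set E}
    (hV : recessionCone (lowerLevelSet f) ∩ closure (conicHull V) ⊆ {0})
    (hb : HasErrorBoundOn f V) : HasPositiveGrowthOn f V := by
  obtain ⟨τ, hτ, hb⟩ := hb
  by_contra hcon
  rw [hasPositiveGrowthOn_iff] at hcon
  push Not at hcon
  choose x hxV hxn hfx using fun n : ℕ =>
    hcon (1 / ((n : ℝ) + 1)) Nat.one_div_pos_of_nat ((n : ℝ) + 1)
  have hpos : ∀ n, 0 < ‖x n‖ := fun n => (Nat.cast_add_one_pos n).trans_le (hxn n)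
  -- The factor 2 makes the inequality strict, so a point of S(f) within this distance exists
  -- without a nearest point being needed.
  have hdist : ∀ n, Metric.infDist (x n) (lowerLevelSet f) <
      2 / τ * (1 / ((n : ℝ) + 1) * ‖x n‖) := by
    intro n
    have hn : 0 < 1 / ((n : ℝ) + 1) * ‖x n‖ := mul_pos Nat.one_div_pos_of_nat (hpos n)
    have h1 := (hb _ (hxV n)).trans (max_le (hfx n).le hn.le)
    rw [← le_div_iff₀' hτ] at h1
    refine h1.trans_lt ?_
    rw [div_mul_eq_mul_div (2 : ℝ)]
    exact (div_lt_div_iff_of_pos_right hτ).2 (lt_two_mul_self hn)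
  choose y hyS hxy using fun n => (Metric.infDist_lt_iff hS).1 (hdist n)
  have hinv : ∀ n, ‖x n‖⁻¹ • x n ∈ Metric.sphere (0 : E) 1 := fun n => by
    simp [norm_smul, (hpos n).ne']
  obtain ⟨z, hz, φ, hφ, hlim⟩ := (isCompact_sphere (0 : E) 1).tendsto_subseq hinv
  have hzero : Tendsto (fun n => ‖x n‖⁻¹) atTop (𝓝 0) :=
    tendsto_inv_atTop_zero.comp (tendsto_atTop_mono hxn
      (tendsto_atTop_add_const_right _ 1 tendsto_natCast_atTop_atTop))
  have hdiff : Tendsto (fun n => ‖x n‖⁻¹ • x n - ‖x n‖⁻¹ • y n) atTop (𝓝 0) := by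
    have hbound : Tendsto (fun n : ℕ => 2 / τ * (1 / ((n : ℝ) + 1))) atTop (𝓝 0) := by
      simpa using tendsto_one_div_add_atTop_nhds_zero_nat.const_mul (2 / τ)
    refine squeeze_zero_norm (fun n => ?_) hbound
    rw [← smul_sub, norm_smul, norm_inv, norm_norm, inv_mul_le_iff₀ (hpos n), ← dist_eq_norm]
    exact (hxy n).le.trans_eq (by ring)
  have hrec : z ∈ recessionCone (lowerLevelSet f) := by
    refine hf.mem_recessionCone_of_tendsto (t := fun n => ‖x (φ n)‖⁻¹) (y := y ∘ φ)
      (fun n => inv_nonneg.2 (norm_nonneg _)) (hzero.comp hφ.tendsto_atTop) (fun n => hyS _) ?_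
    simpa using hlim.sub (hdiff.comp hφ.tendsto_atTop)
  have hcl : z ∈ closure (conicHull V) := mem_closure_of_tendsto hlim
    (Eventually.of_forall fun n => mem_conicHull.2
      ⟨_, inv_nonneg.2 (norm_nonneg _), x (φ n), hxV _, rfl⟩)
  have hz0 : z = 0 := hV ⟨hrec, hcl⟩
  simp [hz0] at hz

end Recession

end NonlocalErrorBound

theorem mainTheorem6 {E : Type*} [NormedAddCommGroup E] [NormedSpace ℝ E] [FiniteDimensional ℝ E]
    (f : E → ℝ) (hf : NonlocalErrorBound.IsPiecewiseAffine f)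
    (hS : (NonlocalErrorBound.lowerLevelSet f).Nonempty) (V : Set E) :
    (NonlocalErrorBound.HasPositiveGrowthOn f V → NonlocalErrorBound.HasErrorBoundOn f V) ∧
    (NonlocalErrorBound.recessionCone (NonlocalErrorBound.lowerLevelSet f) ∩
        closure (NonlocalErrorBound.conicHull V) = {0} →
      NonlocalErrorBound.HasErrorBoundOn f V → NonlocalErrorBound.HasPositiveGrowthOn f V) := by
  exact ⟨hf.hasErrorBoundOn hS, fun h => hf.hasPositiveGrowthOn hS h.subset⟩
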